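/- Let $M$ be a matroid with ground set $[n]$ and rank function $r$. For a collection $\mathcal B$ of subsets of $[n]$ put $Q(\mathcal B)=\mathrm{conv}\{e_B : B\in\mathcal B\}\subset\mathbb R^n$, where $e_B$ is the incidence vector of $B$, and let $Q(M)$ be the base polytope of $M$, i.e. $Q(\mathcal B)$ for $\mathcal B$ the set of bases of $M$. Let $\sigma$ be a nonempty face of $Q(M)$. For $S\subseteq[n]$ let $H_S=\{x\in\mathbb R^n : \sum_{e\in S}x_e=r(S)\}$. The connected components of a matroid $N$ are the equivalence classes of the following equivalence relation on its ground set: $\alpha$ and $\beta$ are equivalent if $\alpha=\beta$ or there are bases $B,B'$ of $N$ with $B\setminus B'=\{\alpha\}$ and $B'\setminus B=\{\beta\}$. $N$ is connected if it has exactly one connected component. A flag is a chain $\mathcal F=\{\emptyset=S_0\subsetneq S_1\subsetneq\cdots\subsetneq S_m=[n]\}$. It is factor-connected if $(M|_{S_i})/S_{i-1}$ is connected for $i=1,\dots,m$. It realizes $\sigma$ if $\sigma=Q(\mathcal B_\omega)$, where $\omega\in\mathbb R^n$ is a weight vector that is constant on each $S_i\setminus S_{i-1}$, with values strictly increasing in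 $i$, and $\mathcal B_\omega$ is the set of bases $B$ of $M$ that minimize $\sum_{e\in B}\omega_e$ (this set does not depend on the choice of $\omega$). Let $L_\sigma$ be the set of all subsets of $[n]$ that occur in some factor-connected flag realizing $\sigma$, ordered by inclusion. Then there is exactly one matroid $M_\sigma$ on $[n]$ with $Q(M_\sigma)=\sigma$, and the following holds. (i) There is a partial order on the set $P_\sigma$ of connected components of $M_\sigma$ such that, for distinct components $C_1,C_2$, one has $C_1<C_2$ if and only if every $S\subseteq[n]$ with $C_2\subseteq S$ and $\sigma\subseteq H_S$ also satisfies $C_1\subseteq S$. (ii) $L_\sigma$ is closed under union and intersection, and it is the lattice of order ideals (down-sets) of $P_\sigma$: the map $S\mapsto\{C\in P_\sigma : C\subseteq S\}$ is an isomorphism of lattices from $L_\sigma$ onto the set of order ideals of $P_\sigma$ ordered by inclusion, with inverse $I\mapsto\bigcup_{C\in I}C$. -/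

import Mathlib

open scoped Matroid

/-- The incidence vector `e_B` of a subset `B` of the ground set. -/
noncomputable def incidenceVector {n : ℕ} (B : Set (Fin n)) : Fin n → ℝ :=
  B.indicator 1

/-- The polytope `Q(𝓑) = conv {e_B : B ∈ 𝓑}` of a collection `𝓑` of subsets. -/
noncomputable def polytopeOf {n : ℕ} (𝓑 : Set (Set (Fin n))) : Set (Fin n → ℝ) :=
  convexHull ℝ (incidenceVector '' 𝓑)

/-- The matroid base polytope `Q(M)`. -/
noncomputable def basePolytope {n : ℕ} (M : Matroid (Fin n)) : Set (Fin n → ℝ) :=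
  polytopeOf {B | M.IsBase B}

/-- `σ` is a (nonempty) face of `Q(M)`: the set of points of `Q(M)` at which some linear form
is optimal. -/
def IsFaceOf {n : ℕ} (σ : Set (Fin n → ℝ)) (M : Matroid (Fin n)) : Prop :=
  σ.Nonempty ∧ IsExposed ℝ (basePolytope M) σ

/-- The hyperplane `H_S = {x : ∑_{e ∈ S} x_e = r(S)}`, with `r` the rank function of `M`. -/
noncomputable def rankHyperplane {n : ℕ} (M : Matroid (Fin n)) (S : Set (Fin n)) :
    Set (Fin n → ℝ) :=
  {x | ∑ e, S.indicator x e = ((M.eRk S).toNat : ℝ)}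

/-- Equivalence of ground set elements: equal, or exchanged by a pair of bases. -/
def ExchangeEquiv {n : ℕ} (N : Matroid (Fin n)) (a b : Fin n) : Prop :=
  a = b ∨ ∃ B B', N.IsBase B ∧ N.IsBase B' ∧ B \ B' = {a} ∧ B' \ B = {b}

/-- `C` is a connected component of `N`: the class of some element of the ground set. -/
def IsConnComponent {n : ℕ} (N : Matroid (Fin n)) (C : Set (Fin n)) : Prop :=
  ∃ a ∈ N.E, C = {b | b ∈ N.E ∧ ExchangeEquiv N a b}

/-- A matroid is connected if it has exactly one connected component. -/
def IsConnectedMatroid {n : ℕ} (N : Matroid (Fin n)) : Prop :=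
  ∃! C, IsConnComponent N C

/-- The type of connected components of `N`. It carries no order of its own. -/
@[ext] structure ConnComponent {n : ℕ} (N : Matroid (Fin n)) where
  carrier : Set (Fin n)
  isConnComponent : IsConnComponent N carrier

/-- A flag `∅ = S₀ ⊂ S₁ ⊂ ⋯ ⊂ S_m = [n]` of subsets of `[n]`
(`m = 0` can only occur when `n = 0`). -/
structure SubsetFlag (n m : ℕ) where
  sets : Fin (m + 1) → Set (Fin n)
  strictMono : StrictMono sets
  bot_eq : sets 0 = ∅
  top_eq : sets (Fin.last m) = Set.univ

/-- The `i`-th block `S_{i+1} \ S_i` of a flag. -/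
def SubsetFlag.block {n m : ℕ} (F : SubsetFlag n m) (i : Fin m) : Set (Fin n) :=
  F.sets i.succ \ F.sets i.castSucc

/-- All the matroids `(M|S_{i+1})/S_i` are connected. -/
def SubsetFlag.FactorConnected {n m : ℕ} (F : SubsetFlag n m) (M : Matroid (Fin n)) : Prop :=
  ∀ i : Fin m, IsConnectedMatroid ((M ↾ F.sets i.succ) ／ F.sets i.castSucc)

/-- `F = F(ω)`: the weight `ω` is constant on each block of `F`, and its values increase strictly
from block to block. -/
def SubsetFlag.IsFlagOf {n m : ℕ} (F : SubsetFlag n m) (ω : Fin n → ℝ) : Prop :=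
  (∀ i, ∀ a ∈ F.block i, ∀ b ∈ F.block i, ω a = ω b) ∧
    ∀ i j, i < j → ∀ a ∈ F.block i, ∀ b ∈ F.block j, ω a < ω b

/-- The `ω`-weight `∑_{e ∈ B} ω_e` of a set `B`. -/
noncomputable def setWeight {n : ℕ} (ω : Fin n → ℝ) (B : Set (Fin n)) : ℝ :=
  ∑ e, B.indicator ω e

/-- The bases of `M_ω`: the bases of `M` that have minimum `ω`-weight. -/
def minWeightBases {n : ℕ} (M : Matroid (Fin n)) (ω : Fin n → ℝ) : Set (Set (Fin n)) :=
  {B | M.IsBase B ∧ ∀ B', M.IsBase B' → setWeight ω B ≤ setWeight ω B'}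

/-- `σ = Q(M_F)`, where `M_F = M_ω` for a weight `ω` with `F(ω) = F`
(it does not matter for which one). -/
def SubsetFlag.Realizes {n m : ℕ} (F : SubsetFlag n m) (M : Matroid (Fin n))
    (σ : Set (Fin n → ℝ)) : Prop :=
  ∃ ω : Fin n → ℝ, F.IsFlagOf ω ∧ σ = polytopeOf (minWeightBases M ω)

/-- `L_σ`: all subsets of `[n]` that occur in some factor-connected flag `F` with `σ = Q(M_F)`. -/
def faceLattice {n : ℕ} (M : Matroid (Fin n)) (σ : Set (Fin n → ℝ)) : Set (Set (Fin n)) :=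
  {S | ∃ (m : ℕ) (F : SubsetFlag n m),
    F.FactorConnected M ∧ F.Realizes M σ ∧ ∃ i, F.sets i = S}

/-! A face is `Q` of the bases of minimum weight for some `ω`, and these bases form a matroid `N`.
Call `S` tight if each base of `N` meets `S` in a basis of `S`; by counting, this says σ ⊆ H_S.
Tight sets form a finite sublattice containing ∅ and [n], so they are the down-sets of the preorder
"every tight set containing a contains b" (`mem_tightSets_of_forall`). Its classes are the
components of `N`: a tight set never splits a component (`mem_of_exchangeEquiv`), and tight sets
separate components (`exchangeEquiv_of_forall_mem_iff`).

It remains to see that L_σ is the set of tight sets (`mem_faceLattice_iff`). Members of a realizing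
flag are tight by exchange. Conversely, a linear extension of the component order that lists a given
tight `S` first yields a flag of tight sets with single components as blocks. Its factors are
connected, and it realizes σ because tightness fixes how many elements of a base lie in each block.
-/

/-! ### Faces of the polytope and minimum-weight bases -/

/-- The points of a convex hull that maximize a linear form lie in the convex hull of the
maximizing generators. -/
theorem mem_convexHull_inter_of_forall_le {E : Type*} [AddCommGroup E] [Module ℝ E]
    (l : E →ₗ[ℝ] ℝ) {V : Set E} {m : ℝ} (hV : ∀ v ∈ V, l v ≤ m) {x : E}
    (hx : x ∈ convexHull ℝ V) (hlx : l x = m) : x ∈ convexHull ℝ (V ∩ {v | l v = m}) := by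
  have hl : ∀ p ∈ convexHull ℝ (V ∩ {v | l v = m}), l p = m := fun p hp =>
    convexHull_min Set.inter_subset_right (convex_hyperplane l.isLinear m) hp
  -- The hull of the maximizers together with the open half-space `l < m` is convex and contains
  -- `V`.
  have hsub : convexHull ℝ V ⊆ convexHull ℝ (V ∩ {v | l v = m}) ∪ {v | l v < m} := by
    refine convexHull_min (fun v hv => ?_) (convex_iff_forall_pos.2 ?_)
    · rcases (hV v hv).eq_or_lt with h | h
      · exact Or.inl (subset_convexHull ℝ _ ⟨hv, h⟩)
      · exact Or.inr h
    · rintro p hp q hq a b ha hb hab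
      have hm : m = a * m + b * m := by rw [← add_mul, hab, one_mul]
      rcases hp with hp | hp <;> rcases hq with hq | hq
      · exact Or.inl (convex_convexHull ℝ _ hp hq ha.le hb.le hab)
      · right
        have := hl p hp
        simp only [Set.mem_ofPred_eq, map_add, map_smul, smul_eq_mul] at hq ⊢
        rw [this]; nlinarith
      · right
        have := hl q hq
        simp only [Set.mem_ofPred_eq, map_add, map_smul, smul_eq_mul] at hp ⊢
        rw [this]; nlinarith
      · right
        simp only [Set.mem_ofPred_eq, map_add, map_smul, smul_eq_mul] at hp hq ⊢
        nlinarith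
  exact (hsub hx).resolve_right fun h => (ne_of_lt h) hlx

variable {n : ℕ}

theorem setWeight_eq_sum_mul (ω : Fin n → ℝ) (B : Set (Fin n)) :
    setWeight ω B = ∑ e, ω e * incidenceVector B e := by
  classical
  refine Finset.sum_congr rfl fun e _ => ?_
  by_cases h : e ∈ B <;> simp [incidenceVector, h]

/-- The form with coefficients 1 on `B` and -1 off `B` has `e_B` as its only maximizer among 0/1
vectors. Hence a polytope determines its family of sets. -/
theorem incidenceVector_mem_polytopeOf {Bs : Set (Set (Fin n))} {B : Set (Fin n)} :
    incidenceVector B ∈ polytopeOf Bs ↔ B ∈ Bs := by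
  classical
  refine ⟨fun h => ?_, fun h => subset_convexHull ℝ _ ⟨B, h, rfl⟩⟩
  let l : (Fin n → ℝ) →ₗ[ℝ] ℝ :=
    ∑ e, (if e ∈ B then (1 : ℝ) else -1) • LinearMap.proj e
  have hl : ∀ A : Set (Fin n), l (incidenceVector A) =
      ∑ e, (if e ∈ B then (1 : ℝ) else -1) * incidenceVector A e := fun A => by
    simp only [l, LinearMap.sum_apply, LinearMap.smul_apply, LinearMap.proj_apply, smul_eq_mul]
  have hle : ∀ A : Set (Fin n), ∀ e, (if e ∈ B then (1 : ℝ) else -1) * incidenceVector A e ≤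
      (if e ∈ B then (1 : ℝ) else -1) * incidenceVector B e := fun A e => by
    by_cases h1 : e ∈ B <;> by_cases h2 : e ∈ A <;> simp [incidenceVector, h1, h2]
  have key := mem_convexHull_inter_of_forall_le l (m := l (incidenceVector B)) (by
    rintro _ ⟨A, -, rfl⟩
    rw [hl, hl]
    exact Finset.sum_le_sum fun e _ => hle A e) h rfl
  obtain ⟨_, ⟨A, hA, rfl⟩, hAl⟩ := convexHull_nonempty_iff.1 ⟨_, key⟩
  rw [Set.mem_ofPred_eq, hl, hl, Finset.sum_eq_sum_iff_of_le fun e _ => hle A e] at hAl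
  suffices A = B from this ▸ hA
  ext e
  have := hAl e (Finset.mem_univ e)
  by_cases h1 : e ∈ B <;> by_cases h2 : e ∈ A <;> simp_all [incidenceVector]

theorem polytopeOf_injective : Function.Injective (polytopeOf (n := n)) := fun A B h => by
  ext S
  rw [← incidenceVector_mem_polytopeOf, h, incidenceVector_mem_polytopeOf]

theorem IsFaceOf.exists_eq_polytopeOf {σ : Set (Fin n → ℝ)} {M : Matroid (Fin n)}
    (h : IsFaceOf σ M) : ∃ ω : Fin n → ℝ, σ = polytopeOf (minWeightBases M ω) := by
  classical
  obtain ⟨hne, hexp⟩ := h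
  obtain ⟨l, hl⟩ := hexp hne
  -- The sign turns the maximized exposing functional into a minimized weight.
  have hlB : ∀ B, l (incidenceVector B) = -setWeight (fun e => -l (Pi.single e 1)) B := fun B => by
    rw [setWeight_eq_sum_mul, ← Finset.sum_neg_distrib]
    conv_lhs => rw [pi_eq_sum_univ' (incidenceVector B)]
    simp only [map_sum, map_smul, smul_eq_mul]
    exact Finset.sum_congr rfl fun e _ => by
      rw [neg_mul, neg_neg, mul_comm]
  refine ⟨fun e => -l (Pi.single e 1), Set.Subset.antisymm (fun x hx => ?_) ?_⟩
  · rw [hl] at hx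
    have := mem_convexHull_inter_of_forall_le l.toLinearMap (m := l x) (fun v hv =>
      hx.2 v (subset_convexHull ℝ _ hv)) hx.1 rfl
    refine convexHull_mono ?_ this
    rintro _ ⟨⟨B, hB, rfl⟩, hBl⟩
    refine ⟨B, ⟨hB, fun B' hB' => ?_⟩, rfl⟩
    have h1 := hx.2 (incidenceVector B') (subset_convexHull ℝ _ ⟨B', hB', rfl⟩)
    have h2 : l (incidenceVector B) = l x := hBl
    rw [← h2, hlB, hlB] at h1
    linarith
  · obtain ⟨x, hx⟩ := hne
    have hconv : Convex ℝ σ := hexp.convex (convex_convexHull ℝ _)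
    refine convexHull_min ?_ hconv
    rintro _ ⟨B, hB, rfl⟩
    rw [hl]
    refine ⟨subset_convexHull ℝ _ ⟨B, hB.1, rfl⟩, fun y hy => ?_⟩
    refine convexHull_min (t := {y | l y ≤ l (incidenceVector B)}) ?_
      (convex_halfSpace_le l.toLinearMap.isLinear _) hy
    rintro _ ⟨B', hB', rfl⟩
    rw [Set.mem_ofPred_eq, hlB, hlB]
    linarith [hB.2 B' hB']

/-- The coordinate sum over `S` is `|B ∩ S|`, and an independent subset of `S` is a basis of `S`
exactly when its size is the rank. -/
theorem incidenceVector_mem_rankHyperplane {M : Matroid (Fin n)} (hM : M.E = Set.univ)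
    {B S : Set (Fin n)} (hB : M.IsBase B) :
    incidenceVector B ∈ rankHyperplane M S ↔ M.IsBasis (B ∩ S) S := by
  classical
  have h1 : ∑ e, S.indicator (incidenceVector B) e = ((B ∩ S).ncard : ℝ) := by
    rw [incidenceVector, Set.indicator_indicator, Set.inter_comm]
    simp [Set.indicator_apply, Set.ncard_eq_toFinset_card', -Set.mem_inter_iff,
      -Set.toFinset_inter, Set.filter_mem_univ_eq_toFinset]
  rw [rankHyperplane, Set.mem_ofPred_eq, h1, Nat.cast_inj,
    Matroid.isBasis_iff_indep_encard_eq_of_finite (Set.toFinite _) (by simp [hM])]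
  have h2 := M.eRk_le_encard S
  have h3 : M.eRk S ≠ ⊤ := fun h => by
    rw [h, top_le_iff, Set.encard_eq_top_iff] at h2
    exact h2 (Set.toFinite S)
  refine ⟨fun h => ⟨Set.inter_subset_right, hB.indep.subset Set.inter_subset_left, ?_⟩, fun h => ?_⟩
  · rw [← (Set.toFinite (B ∩ S)).cast_ncard_eq, h, ENat.natCast_toNat h3]
  · rw [← h.2.2, Set.ncard_def]

theorem convex_rankHyperplane (M : Matroid (Fin n)) (S : Set (Fin n)) :
    Convex ℝ (rankHyperplane M S) := by
  classical
  refine convex_hyperplane (f := fun x : Fin n → ℝ => ∑ e, S.indicator x e)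
    ⟨fun x y => ?_, fun c x => ?_⟩ _
  · simp [Set.indicator_add', Finset.sum_add_distrib]
  · simp [Finset.mul_sum, Set.indicator_apply]

theorem polytopeOf_subset_rankHyperplane {M : Matroid (Fin n)} (hM : M.E = Set.univ)
    {Bs : Set (Set (Fin n))} (hBs : ∀ B ∈ Bs, M.IsBase B) {S : Set (Fin n)} :
    polytopeOf Bs ⊆ rankHyperplane M S ↔ ∀ B ∈ Bs, M.IsBasis (B ∩ S) S := by
  rw [polytopeOf, (convex_rankHyperplane M S).convexHull_subset_iff, Set.image_subset_iff]
  exact forall₂_congr fun B hB => incidenceVector_mem_rankHyperplane hM (hBs B hB)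

theorem setWeight_eq_sum (ω : Fin n → ℝ) (B : Set (Fin n)) [Fintype B] :
    setWeight ω B = ∑ e ∈ B.toFinset, ω e := by
  classical
  rw [setWeight, ← Finset.sum_filter_add_sum_filter_not Finset.univ (· ∈ B),
    Finset.sum_eq_zero (s := Finset.univ.filter (· ∉ B)) fun e he => by
      simpa using fun h => absurd h (by simpa using he), add_zero]
  refine Finset.sum_congr (by ext; simp) fun e he => ?_
  simp_all

theorem setWeight_insert (ω : Fin n → ℝ) {A : Set (Fin n)} {x : Fin n} (hx : x ∉ A) :
    setWeight ω (insert x A) = ω x + setWeight ω A := by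
  classical
  rw [setWeight_eq_sum, setWeight_eq_sum, Set.toFinset_insert, Finset.sum_insert (by simpa)]

theorem setWeight_exchange (ω : Fin n → ℝ) {B : Set (Fin n)} {x y : Fin n} (hx : x ∉ B)
    (hy : y ∈ B) : setWeight ω (insert x (B \ {y})) + ω y = setWeight ω B + ω x := by
  have h : setWeight ω B = ω y + setWeight ω (B \ {y}) := by
    rw [← setWeight_insert ω (fun h => h.2 rfl), Set.insert_sdiff_singleton, Set.insert_eq_of_mem hy]
  rw [setWeight_insert ω (fun h => hx h.1), h]
  ring

theorem le_of_mem_minWeightBases {M : Matroid (Fin n)} {ω : Fin n → ℝ} {B : Set (Fin n)}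
    (hB : B ∈ minWeightBases M ω) {x y : Fin n} (hx : x ∉ B) (hy : y ∈ B)
    (h : M.IsBase (insert x (B \ {y}))) : ω y ≤ ω x := by
  linarith [hB.2 _ h, setWeight_exchange ω hx hy]

theorem exchange_mem_minWeightBases {M : Matroid (Fin n)} {ω : Fin n → ℝ} {B : Set (Fin n)}
    (hB : B ∈ minWeightBases M ω) {x y : Fin n} (hx : x ∉ B) (hy : y ∈ B)
    (h : M.IsBase (insert x (B \ {y}))) (hxy : ω x ≤ ω y) :
    insert x (B \ {y}) ∈ minWeightBases M ω :=
  ⟨h, fun B' hB' => by linarith [hB.2 _ hB', setWeight_exchange ω hx hy]⟩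

theorem minWeightBases_nonempty (M : Matroid (Fin n)) (ω : Fin n → ℝ) :
    (minWeightBases M ω).Nonempty := by
  obtain ⟨B, hB, h⟩ := Set.exists_min_image {B | M.IsBase B} (setWeight ω) (Set.toFinite _)
    M.exists_isBase
  exact ⟨B, hB, h⟩

/-! ### Exchange and circuits -/

namespace Matroid

variable {α : Type*} {M : Matroid α}

/-- The symmetric exchange property of bases. -/
theorem IsBase.symm_exchange {B B' : Set α} (hB : M.IsBase B) (hB' : M.IsBase B') {a : α}
    (ha : a ∈ B \ B') :
    ∃ b ∈ B' \ B, M.IsBase (insert b (B \ {a})) ∧ M.IsBase (insert a (B' \ {b})) := by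
  have haE := hB.subset_ground ha.1
  have hC := hB'.fundCircuit_isCircuit haE ha.2
  have hacl : a ∈ M.closure B' := by rwa [hB'.closure_eq]
  -- Otherwise `a` would lie in the closure of `B \ {a}`, since the rest of its circuit does.
  have h : ¬ M.fundCircuit a B' \ {a} ⊆ M.closure (B \ {a}) := fun h =>
    hB.indep.notMem_closure_sdiff_of_mem ha.1 <|
      M.closure_subset_closure_of_subset_closure h
        (hC.mem_closure_sdiff_singleton_of_mem (M.mem_fundCircuit a B'))
  obtain ⟨b, ⟨hbC, hba⟩, hb⟩ := Set.not_subset.1 h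
  have hbB' : b ∈ B' := (M.fundCircuit_subset_insert a B' hbC).resolve_left hba
  have hbB : b ∉ B := fun hbB =>
    hb (M.mem_closure_of_mem ⟨hbB, hba⟩ (Set.sdiff_subset.trans hB.subset_ground))
  refine ⟨b, ⟨hbB', hbB⟩, ?_, ?_⟩
  · exact hB.exchange_base_of_notMem_closure ha.1 hb (hB'.subset_ground hbB')
  · rw [hB'.indep.mem_fundCircuit_iff hacl ha.2] at hbC
    rw [Set.insert_sdiff_singleton_comm (Ne.symm hba)]
    exact hB'.exchange_isBase_of_indep' hbB' ha.2 hbC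

/-- A base `B` spans a set `S` within `S` if no element of `S` can be exchanged for an element
outside of `S`. -/
theorem IsBase.inter_isBasis_of_forall_not_isBase {B S : Set α} (hB : M.IsBase B) (hS : S ⊆ M.E)
    (h : ∀ x ∈ S, x ∉ B → ∀ y ∈ B, y ∉ S → ¬ M.IsBase (insert x (B \ {y}))) :
    M.IsBasis (B ∩ S) S := by
  rw [isBasis_iff_indep_subset_closure]
  refine ⟨hB.indep.subset Set.inter_subset_left, Set.inter_subset_right, fun x hx => ?_⟩
  by_cases hxB : x ∈ B
  · exact M.mem_closure_of_mem ⟨hxB, hx⟩ (Set.inter_subset_right.trans hS)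
  have hxcl : x ∈ M.closure B := by rw [hB.closure_eq]; exact hS hx
  rw [mem_closure_iff_exists_isCircuit fun h => hxB h.1]
  refine ⟨M.fundCircuit x B, fun y hy => ?_, hB.fundCircuit_isCircuit (hS hx) hxB,
    M.mem_fundCircuit x B⟩
  obtain rfl | hyB := M.fundCircuit_subset_insert x B hy
  · exact Set.mem_insert _ _
  by_contra hyS
  have hyS : y ∉ S := fun h' => hyS (Or.inr ⟨hyB, h'⟩)
  have hxy : x ≠ y := fun h' => hxB (h' ▸ hyB)
  rw [hB.indep.mem_fundCircuit_iff hxcl hxB] at hy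
  refine h x hx hxB y hyB hyS ?_
  rw [Set.insert_sdiff_singleton_comm hxy]
  exact hB.exchange_isBase_of_indep' hyB hxB hy

/-- Lying on a common circuit is a transitive relation. -/
theorem IsCircuit.exists_isCircuit_of_inter_nonempty [Finite α] {C₁ C₂ : Set α} {a c : α}
    (h₁ : M.IsCircuit C₁) (h₂ : M.IsCircuit C₂) (ha : a ∈ C₁) (hc : c ∈ C₂)
    (h : (C₁ ∩ C₂).Nonempty) : ∃ C, M.IsCircuit C ∧ a ∈ C ∧ c ∈ C := by
  induction hk : (C₁ ∪ C₂).ncard using Nat.strong_induction_on generalizing C₁ C₂ with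
  | _ k ih =>
    subst hk
    by_cases haC : a ∈ C₂
    · exact ⟨C₂, h₂, haC, hc⟩
    by_cases hcC : c ∈ C₁
    · exact ⟨C₁, h₁, ha, hcC⟩
    obtain ⟨f, hf₁, hf₂⟩ := h
    obtain ⟨C₃, hC₃, h₃, ha₃⟩ := h₁.strong_elimination h₂ hf₁ hf₂ ha haC
    obtain ⟨C₄, hC₄, h₄, hc₄⟩ := h₂.strong_elimination h₁ hf₂ hf₁ hc hcC
    have h32 : (C₃ ∩ C₂).Nonempty := by
      by_contra hne
      have hsub : C₃ ⊆ C₁ := fun x hx =>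
        (hC₃ hx).1.resolve_right fun hx' => hne ⟨x, hx, hx'⟩
      exact (hC₃ (h₃.eq_of_subset_isCircuit h₁ hsub ▸ hf₁)).2 rfl
    -- If `C₃ ∪ C₂` is not smaller, then `C₃` contains `C₁ \ C₂`, hence meets `C₄`, and `C₃ ∪ C₄` is
    -- smaller because it misses `f`.
    by_cases hsub : C₁ ∪ C₂ ⊆ C₃ ∪ C₂
    · have hx : ∃ x ∈ C₄, x ∉ C₂ := by
        by_contra! hsub'
        exact (hC₄ (h₄.eq_of_subset_isCircuit h₂ hsub' ▸ hf₂)).2 rfl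
      obtain ⟨x, hx₄, hx₂⟩ := hx
      have hx₁ : x ∈ C₁ := (hC₄ hx₄).1.resolve_left hx₂
      have hx₃ : x ∈ C₃ := (hsub (Or.inl hx₁)).resolve_right hx₂
      refine ih _ (Set.ncard_lt_ncard ?_ (Set.toFinite _)) h₃ h₄ ha₃ hc₄ ⟨x, hx₃, hx₄⟩ rfl
      rw [Set.union_comm] at hC₄
      refine ⟨Set.union_subset (hC₃.trans Set.sdiff_subset) (hC₄.trans Set.sdiff_subset), ?_⟩
      exact fun hle => (Set.union_subset hC₃ hC₄ (hle (Or.inl hf₁))).2 rfl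
    · exact ih _ (Set.ncard_lt_ncard
        ⟨Set.union_subset (hC₃.trans Set.sdiff_subset) Set.subset_union_right, hsub⟩
        (Set.toFinite _)) h₃ h₂ ha₃ hc h32 rfl

end Matroid

/-! ### The matroid of a face and its components -/

/-- In a symmetric exchange, minimality of `B'` shows that the element entering `B` is no heavier
than the one leaving, so the new base is again minimal. -/
theorem exists_matroid_isBase_iff_mem_minWeightBases (M : Matroid (Fin n)) (ω : Fin n → ℝ) :
    ∃ N : Matroid (Fin n), N.E = Set.univ ∧ ∀ B, N.IsBase B ↔ B ∈ minWeightBases M ω := by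
  refine ⟨Matroid.ofIsBaseOfFinite (E := Set.univ) (Set.toFinite _) (· ∈ minWeightBases M ω)
    (minWeightBases_nonempty M ω) ?_ fun _ _ => Set.subset_univ _, rfl, fun B => Iff.rfl⟩
  intro B B' hB hB' a ha
  obtain ⟨b, hb, h, h'⟩ := hB.1.symm_exchange hB'.1 ha
  exact ⟨b, hb, exchange_mem_minWeightBases hB hb.2 ha.1 h
    (le_of_mem_minWeightBases hB' ha.2 hb.1 h')⟩

/-- For `b` outside a base `B`, the elements of `B` replaceable by `b` are those of its fundamental
circuit. Transitivity is then a statement about circuits. -/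
theorem exchangeEquiv_iff_exists_isCircuit {N : Matroid (Fin n)} {a b : Fin n} :
    ExchangeEquiv N a b ↔ a = b ∨ ∃ C, N.IsCircuit C ∧ a ∈ C ∧ b ∈ C := by
  by_cases hab : a = b
  · simp [ExchangeEquiv, hab]
  simp only [ExchangeEquiv, hab, false_or]
  constructor
  · rintro ⟨B, B', hB, hB', h1, h2⟩
    have hb : b ∈ B' \ B := h2 ▸ rfl
    obtain ⟨f, hf, rfl⟩ := hB.eq_exchange_of_sdiff_eq_singleton hB' h1
    obtain rfl : f = b := by rw [h2] at hf; exact hf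
    have hbE := hB'.subset_ground hb.1
    refine ⟨N.fundCircuit f B, hB.fundCircuit_isCircuit hbE hb.2, ?_, N.mem_fundCircuit f B⟩
    rw [hB.indep.mem_fundCircuit_iff (by rwa [hB.closure_eq]) hb.2]
    exact hB'.indep
  · rintro ⟨C, hC, ha, hb⟩
    obtain ⟨B, hB, hCB⟩ := (hC.sdiff_singleton_indep hb).exists_isBase_superset
    have haB : a ∈ B := hCB ⟨ha, hab⟩
    have hbB : b ∉ B := fun hbB => hC.not_indep <| hB.indep.subset fun x hx => by
      by_cases hxb : x = b
      · exact hxb ▸ hbB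
      · exact hCB ⟨hx, hxb⟩
    have hbcl : b ∈ N.closure B := by rw [hB.closure_eq]; exact hC.subset_ground hb
    have hCeq : C = N.fundCircuit b B := hC.eq_fundCircuit_of_subset hB.indep fun x hx => by
      by_cases hxb : x = b
      · exact Or.inl hxb
      · exact Or.inr (hCB ⟨hx, hxb⟩)
    rw [hCeq, hB.indep.mem_fundCircuit_iff hbcl hbB] at ha
    refine ⟨B, insert b B \ {a}, hB, hB.exchange_isBase_of_indep' haB hbB ha, ?_, ?_⟩
    · ext x; simp only [Set.mem_sdiff, Set.mem_insert_iff, Set.mem_singleton_iff]; grind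
    · ext x; simp only [Set.mem_sdiff, Set.mem_insert_iff, Set.mem_singleton_iff]; grind

theorem ExchangeEquiv.equivalence (N : Matroid (Fin n)) : Equivalence (ExchangeEquiv N) where
  refl _ := Or.inl rfl
  symm := by
    rintro a b (rfl | ⟨B, B', hB, hB', h, h'⟩)
    · exact Or.inl rfl
    · exact Or.inr ⟨B', B, hB', hB, h', h⟩
  trans := by
    intro a b c hab hbc
    rw [exchangeEquiv_iff_exists_isCircuit] at *
    obtain rfl | ⟨C₁, h₁, ha, hb⟩ := hab
    · exact hbc
    obtain rfl | ⟨C₂, h₂, hb', hc⟩ := hbc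
    · exact Or.inr ⟨C₁, h₁, ha, hb⟩
    exact Or.inr (h₁.exists_isCircuit_of_inter_nonempty h₂ ha hc ⟨b, hb, hb'⟩)

/-! ### Tight sets -/

/-- The sets `S` for which every base of `N` contains a basis of `M|S`. -/
def tightSets (M N : Matroid (Fin n)) : Set (Set (Fin n)) :=
  {S | ∀ B, N.IsBase B → M.IsBasis (B ∩ S) S}

section

variable {M N : Matroid (Fin n)} {ω : Fin n → ℝ}

theorem empty_mem_tightSets : ∅ ∈ tightSets M N := fun B _ => by
  rw [Set.inter_empty]; exact M.empty_indep.isBasis_self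

theorem univ_mem_tightSets (hM : M.E = Set.univ) (hNM : ∀ B, N.IsBase B → M.IsBase B) :
    Set.univ ∈ tightSets M N := fun B hB => by
  rw [Set.inter_univ, ← hM]; exact (hNM B hB).isBasis_ground

/-- For intersections: closure commutes with intersection on subsets of one independent set, here
the base `B`. -/
theorem isSublattice_tightSets (hNM : ∀ B, N.IsBase B → M.IsBase B) :
    IsSublattice (tightSets M N) := by
  refine ⟨fun S hS T hT B hB => ?_, fun S hS T hT B hB => ?_⟩
  · have hi : M.Indep (B ∩ (S ∪ T)) := (hNM B hB).indep.subset Set.inter_subset_left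
    have := (hS B hB).union_isBasis_union (hT B hB) (by rwa [← Set.inter_union_distrib_left])
    rwa [← Set.inter_union_distrib_left] at this
  · have hi := (hNM B hB).indep
    show M.IsBasis (B ∩ (S ∩ T)) (S ∩ T)
    rw [Matroid.isBasis_iff_indep_subset_closure]
    refine ⟨hi.subset Set.inter_subset_left, Set.inter_subset_right, ?_⟩
    rw [Set.inter_inter_distrib_left, Matroid.Indep.closure_inter_eq_inter_closure
      (hi.subset (Set.union_subset Set.inter_subset_left Set.inter_subset_left))]
    exact Set.inter_subset_inter (hS B hB).subset_closure (hT B hB).subset_closure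

/-- If `b ∉ S`, then `B' ∩ S` is properly contained in `B ∩ S`, yet both are bases of `S`. -/
theorem mem_of_exchangeEquiv {S : Set (Fin n)} (hS : S ∈ tightSets M N) {a b : Fin n}
    (hab : ExchangeEquiv N a b) (ha : a ∈ S) : b ∈ S := by
  obtain rfl | ⟨B, B', hB, hB', h, h'⟩ := hab
  · exact ha
  by_contra hb
  have haB : a ∈ B \ B' := h ▸ rfl
  have hsub : B' ∩ S ⊆ B ∩ S := fun x hx => by
    refine ⟨?_, hx.2⟩
    by_contra hxB
    have hxb : x ∈ B' \ B := ⟨hx.1, hxB⟩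
    rw [h'] at hxb
    exact hb (hxb ▸ hx.2)
  have heq := (hS B' hB').eq_of_subset_indep (hS B hB).indep hsub Set.inter_subset_right
  have haS : a ∈ B' ∩ S := heq ▸ ⟨haB.1, ha⟩
  exact haB.2 haS.1

/-- Such a `T` is the union, over its elements, of the smallest tight set containing each. -/
theorem mem_tightSets_of_forall (hM : M.E = Set.univ) (hNM : ∀ B, N.IsBase B → M.IsBase B)
    {T : Set (Fin n)} (hT : ∀ a ∈ T, ∀ b, (∀ S ∈ tightSets M N, a ∈ S → b ∈ S) → b ∈ T) :
    T ∈ tightSets M N := by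
  have hlat := isSublattice_tightSets hNM
  have hmem : ∀ a, ⋂₀ {S | S ∈ tightSets M N ∧ a ∈ S} ∈ tightSets M N := fun a =>
    hlat.infClosed.sInf_mem (Set.toFinite _) (univ_mem_tightSets hM hNM) fun S hS => hS.1
  have hT' : T = ⋃ a ∈ T, ⋂₀ {S | S ∈ tightSets M N ∧ a ∈ S} := by
    ext b
    simp only [Set.mem_iUnion, Set.mem_sInter, Set.mem_ofPred_eq, and_imp, exists_prop]
    exact ⟨fun hb => ⟨b, hb, fun S _ h => h⟩, fun ⟨a, ha, h⟩ => hT a ha b h⟩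
  rw [hT']
  exact hlat.supClosed.biSup_mem (Set.toFinite T) empty_mem_tightSets fun a _ => hmem a

theorem weight_eq_of_exchangeEquiv (hN : ∀ B, N.IsBase B ↔ B ∈ minWeightBases M ω) {a b : Fin n}
    (hab : ExchangeEquiv N a b) : ω a = ω b := by
  obtain rfl | ⟨B, B', hB, hB', h, h'⟩ := hab
  · rfl
  have ha : a ∈ B \ B' := h ▸ rfl
  have hb : b ∈ B' \ B := h' ▸ rfl
  have hBB' : B' = insert b (B \ {a}) := by
    obtain ⟨f, hf, rfl⟩ := hB.eq_exchange_of_sdiff_eq_singleton hB' h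
    obtain rfl : f = b := by rw [h'] at hf; exact hf
    have hne : f ≠ a := fun hfa => hb.2 (hfa ▸ ha.1)
    rw [Set.insert_sdiff_singleton_comm hne]
  rw [hN] at hB hB'
  have h1 := setWeight_exchange ω hb.2 ha.1
  rw [← hBB'] at h1
  linarith [hB.2 _ hB'.1, hB'.2 _ hB.1]

theorem mem_tightSets_of_lt (hM : M.E = Set.univ)
    (hN : ∀ B, N.IsBase B ↔ B ∈ minWeightBases M ω) {S : Set (Fin n)}
    (hS : ∀ x ∈ S, ∀ y ∉ S, ω x < ω y) : S ∈ tightSets M N := fun B hB => by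
  rw [hN] at hB
  exact hB.1.inter_isBasis_of_forall_not_isBase (by simp [hM]) fun x hx hxB y hyB hyS hbase =>
    (hS x hx y hyS).not_ge (le_of_mem_minWeightBases hB hxB hyB hbase)

/-- An exchange bringing in `x` from the set for `y` outside it has `ω a ≤ ω y ≤ ω x`. So `x` is in
the component of `a`, the weights are equal, and the new base is minimal, which puts `y` in that
component too. -/
theorem setOf_lt_union_exchangeEquiv_mem_tightSets (hM : M.E = Set.univ)
    (hN : ∀ B, N.IsBase B ↔ B ∈ minWeightBases M ω) (a : Fin n) :
    {x | ω x < ω a ∨ ExchangeEquiv N a x} ∈ tightSets M N := fun B hB => by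
  have hB' := (hN B).1 hB
  refine hB'.1.inter_isBasis_of_forall_not_isBase (by simp [hM]) fun x hx hxB y hyB hyS hbase => ?_
  have hle := le_of_mem_minWeightBases hB' hxB hyB hbase
  simp only [Set.mem_ofPred_eq, not_or, not_lt] at hx hyS
  obtain hx | hx := hx
  · linarith [hyS.1]
  have hxa := weight_eq_of_exchangeEquiv hN hx
  have hnew := (hN _).2 (exchange_mem_minWeightBases hB' hxB hyB hbase (by linarith [hyS.1]))
  have hyx : ExchangeEquiv N y x := by
    refine Or.inr ⟨B, _, hB, hnew, ?_, ?_⟩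
    · ext z; simp only [Set.mem_sdiff, Set.mem_insert_iff, Set.mem_singleton_iff]; grind
    · ext z; simp only [Set.mem_sdiff, Set.mem_insert_iff, Set.mem_singleton_iff]; grind
  have heq := ExchangeEquiv.equivalence N
  exact hyS.2 (heq.trans hx (heq.symm hyx))

/-- The tight sets separate the connected components. -/
theorem exchangeEquiv_of_forall_mem_iff (hM : M.E = Set.univ)
    (hN : ∀ B, N.IsBase B ↔ B ∈ minWeightBases M ω) {a b : Fin n}
    (h : ∀ S ∈ tightSets M N, a ∈ S ↔ b ∈ S) : ExchangeEquiv N a b := by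
  have heq := ExchangeEquiv.equivalence N
  have h1 := (h _ (setOf_lt_union_exchangeEquiv_mem_tightSets hM hN a)).1 (Or.inr (heq.refl a))
  have h2 := (h _ (setOf_lt_union_exchangeEquiv_mem_tightSets hM hN b)).2 (Or.inr (heq.refl b))
  obtain h1 | h1 := h1
  · obtain h2 | h2 := h2
    · exact absurd h1 h2.not_gt
    · exact heq.symm h2
  · exact h1

/-- Bases of `N` meet `S' \ S` in bases of the minor, so exchanges of `N` between elements of the
block survive there. -/
theorem isConnectedMatroid_restrict_contract {S S' : Set (Fin n)} (hSS' : S ⊆ S')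
    (hS : S ∈ tightSets M N) (hS' : S' ∈ tightSets M N)
    (hne : (S' \ S).Nonempty) (hconn : ∀ a ∈ S' \ S, ∀ b ∈ S' \ S, ExchangeEquiv N a b) :
    IsConnectedMatroid ((M ↾ S') ／ S) := by
  set K := (M ↾ S') ／ S with hK
  have hKE : K.E = S' \ S := rfl
  have hbase : ∀ B, N.IsBase B → K.IsBase (B ∩ (S' \ S)) := fun B hB => by
    have h1 : (M ↾ S').IsBasis (B ∩ S') S' :=
      (Matroid.isBasis_restrict_iff (hS' B hB).subset_ground).2 ⟨hS' B hB, subset_rfl⟩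
    have h2 : (M ↾ S').IsBasis (B ∩ S) S :=
      (Matroid.isBasis_restrict_iff (hS' B hB).subset_ground).2 ⟨hS B hB, hSS'⟩
    have h3 := h1.contract_isBasis h2 (h1.indep.subset (Set.union_subset Set.sdiff_subset
      (Set.inter_subset_inter_right _ hSS')))
    rw [← Matroid.isBasis_ground_iff, hKE, ← Set.inter_sdiff_assoc]
    exact h3
  have hequiv : ∀ a ∈ S' \ S, ∀ b ∈ S' \ S, ExchangeEquiv K a b := fun a ha b hb => by
    obtain rfl | ⟨B, B', hB, hB', h, h'⟩ := hconn a ha b hb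
    · exact Or.inl rfl
    refine Or.inr ⟨_, _, hbase B hB, hbase B' hB', ?_, ?_⟩
    · rw [← Set.inter_sdiff_distrib_right, h]
      exact Set.inter_eq_left.2 (Set.singleton_subset_iff.2 ha)
    · rw [← Set.inter_sdiff_distrib_right, h']
      exact Set.inter_eq_left.2 (Set.singleton_subset_iff.2 hb)
  have hcls : ∀ a ∈ K.E, {b | b ∈ K.E ∧ ExchangeEquiv K a b} = S' \ S := fun a ha => by
    ext b
    exact ⟨fun h => h.1, fun hb => ⟨hb, hequiv a ha b hb⟩⟩
  obtain ⟨a, ha⟩ := hne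
  refine ⟨S' \ S, ⟨a, ha, (hcls a ha).symm⟩, ?_⟩
  rintro _ ⟨b, hb, rfl⟩
  exact hcls b hb

end

/-! ### Flags -/

/-- The flag of initial segments of a surjective indexing of `[n]`. -/
def SubsetFlag.ofIndex {m : ℕ} (f : Fin n → Fin m) (hf : Function.Surjective f) :
    SubsetFlag n m where
  sets i := {x | (f x).castSucc < i}
  strictMono i j hij := by
    refine ⟨fun x hx => lt_trans hx hij, fun hle => ?_⟩
    obtain ⟨k, rfl⟩ := Fin.exists_castSucc_eq.2 (hij.trans_le (Fin.le_last j)).ne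
    obtain ⟨x, rfl⟩ := hf k
    exact lt_irrefl (f x).castSucc (hle hij)
  bot_eq := by ext x; simp
  top_eq := by ext x; simp [Fin.castSucc_lt_last]

theorem SubsetFlag.mem_block_ofIndex {m : ℕ} {f : Fin n → Fin m} (hf : Function.Surjective f)
    {i : Fin m} {x : Fin n} : x ∈ (SubsetFlag.ofIndex f hf).block i ↔ f x = i := by
  change (f x).castSucc < i.succ ∧ ¬ (f x).castSucc < i.castSucc ↔ _
  simp only [Fin.lt_def, Fin.val_castSucc, Fin.val_succ, Fin.ext_iff]
  omega

/-- Differences of the counts give the number of elements in each block, where the weight is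
constant. -/
theorem setWeight_eq_of_ncard_eq {m : ℕ} {f : Fin n → Fin m} {ω : Fin n → ℝ}
    (hω : ∀ x y, f x = f y → ω x = ω y) {B B' : Set (Fin n)}
    (h : ∀ i : Fin (m + 1), (B ∩ {x | (f x).castSucc < i}).ncard =
      (B' ∩ {x | (f x).castSucc < i}).ncard) : setWeight ω B = setWeight ω B' := by
  classical
  have hcard : ∀ (A : Set (Fin n)) (i : Fin m), (A ∩ {x | (f x).castSucc < i.succ}).ncard =
      (A ∩ {x | (f x).castSucc < i.castSucc}).ncard + (A.toFinset.filter (f · = i)).card := by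
    intro A i
    rw [← Set.ncard_coe_finset, ← Set.ncard_union_eq ?_ (Set.toFinite _) (Set.toFinite _)]
    · congr 1
      ext x
      simp only [Set.mem_inter_iff, Set.mem_ofPred_eq, Set.mem_union, Finset.coe_filter,
        Set.mem_toFinset, Fin.lt_def, Fin.val_castSucc, Fin.val_succ, Fin.ext_iff,
        ← and_or_left]
      exact and_congr_right fun _ => Nat.lt_succ_iff_lt_or_eq
    · refine Set.disjoint_left.2 fun x hx hx' => ?_
      have h1 : (f x).castSucc < i.castSucc := hx.2
      have h2 : f x = i := (Finset.mem_filter.1 hx').2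
      exact lt_irrefl _ (h2 ▸ h1)
  have hsum : ∀ (A : Set (Fin n)) (i : Fin m) (x : Fin n), f x = i →
      ∑ e ∈ A.toFinset.filter (f · = i), ω e = (A.toFinset.filter (f · = i)).card • ω x :=
    fun A i x hx => Finset.sum_eq_card_nsmul fun e he =>
      hω _ _ ((Finset.mem_filter.1 he).2.trans hx.symm)
  rw [setWeight_eq_sum, setWeight_eq_sum, ← Finset.sum_fiberwise _ f,
    ← Finset.sum_fiberwise B'.toFinset f]
  refine Finset.sum_congr rfl fun i _ => ?_
  by_cases hi : ∃ x, f x = i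
  · obtain ⟨x, hx⟩ := hi
    rw [hsum B i x hx, hsum B' i x hx]
    congr 1
    have h1 := hcard B i
    have h2 := hcard B' i
    rw [h, h] at h1
    omega
  · push Not at hi
    simp [hi]

theorem SubsetFlag.exists_mem_block {m : ℕ} (F : SubsetFlag n m) {i : Fin (m + 1)} {x : Fin n}
    (hx : x ∈ F.sets i) : ∃ j, x ∈ F.block j ∧ j.castSucc < i := by
  induction i using Fin.induction with
  | zero => rw [F.bot_eq] at hx; exact hx.elim
  | succ i ih =>
    by_cases h : x ∈ F.sets i.castSucc
    · obtain ⟨j, hj, hji⟩ := ih h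
      exact ⟨j, hj, hji.trans (Fin.castSucc_lt_succ)⟩
    · exact ⟨i, ⟨hx, h⟩, Fin.castSucc_lt_succ⟩

theorem SubsetFlag.IsFlagOf.lt {m : ℕ} {F : SubsetFlag n m} {ω : Fin n → ℝ} (h : F.IsFlagOf ω)
    {i : Fin (m + 1)} {x y : Fin n} (hx : x ∈ F.sets i) (hy : y ∉ F.sets i) : ω x < ω y := by
  obtain ⟨j, hj, hji⟩ := F.exists_mem_block hx
  obtain ⟨k, hk, -⟩ := F.exists_mem_block (i := Fin.last m) (x := y) (by simp [F.top_eq])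
  refine h.2 j k ?_ x hj y hk
  by_contra hjk
  have hki : k.succ ≤ i := by
    simp only [Fin.lt_def, Fin.le_def, Fin.val_castSucc, Fin.val_succ] at *
    omega
  exact hy (F.strictMono.monotone hki hk.1)

/-! ### The poset of components and the face lattice -/

section

variable {M N : Matroid (Fin n)} {ω : Fin n → ℝ}

/-- The connected component of an element. -/
def ConnComponent.of (hNE : N.E = Set.univ) (a : Fin n) : ConnComponent N where
  carrier := {b | b ∈ N.E ∧ ExchangeEquiv N a b}
  isConnComponent := ⟨a, hNE ▸ Set.mem_univ a, rfl⟩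

theorem ConnComponent.mem_of_iff (hNE : N.E = Set.univ) {a b : Fin n} :
    b ∈ (ConnComponent.of hNE a).carrier ↔ ExchangeEquiv N a b :=
  ⟨fun h => h.2, fun h => ⟨hNE ▸ Set.mem_univ b, h⟩⟩

theorem ConnComponent.eq_of_mem (hNE : N.E = Set.univ) {C : ConnComponent N} {a : Fin n}
    (ha : a ∈ C.carrier) : C = ConnComponent.of hNE a := by
  have heq := ExchangeEquiv.equivalence N
  obtain ⟨C, c, hc, rfl⟩ := C
  ext b
  rw [ConnComponent.mem_of_iff hNE]
  exact ⟨fun hb => heq.trans (heq.symm ha.2) hb.2, fun hb =>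
    ⟨hNE ▸ Set.mem_univ b, heq.trans ha.2 hb⟩⟩

theorem ConnComponent.exists_eq_of (hNE : N.E = Set.univ) (C : ConnComponent N) :
    ∃ a, C = ConnComponent.of hNE a := by
  obtain ⟨C, a, ha, rfl⟩ := C
  exact ⟨a, rfl⟩

theorem ConnComponent.of_eq_of_iff (hNE : N.E = Set.univ) {a b : Fin n} :
    ConnComponent.of hNE a = ConnComponent.of hNE b ↔ ExchangeEquiv N a b := by
  rw [← ConnComponent.mem_of_iff hNE]
  refine ⟨fun h => ?_, fun h => ConnComponent.eq_of_mem hNE h⟩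
  rw [h, ConnComponent.mem_of_iff]
  exact Or.inl rfl

theorem ConnComponent.of_carrier_subset_iff (hNE : N.E = Set.univ) {S : Set (Fin n)}
    (hS : S ∈ tightSets M N) {a : Fin n} : (ConnComponent.of hNE a).carrier ⊆ S ↔ a ∈ S :=
  ⟨fun h => h ((ConnComponent.mem_of_iff hNE).2 (Or.inl rfl)), fun ha _ hb =>
    mem_of_exchangeEquiv hS ((ConnComponent.mem_of_iff hNE).1 hb) ha⟩

/-- The order on the components: `C₁ ≤ C₂` if every tight set that contains `C₂` contains `C₁`. -/
abbrev componentOrder (hM : M.E = Set.univ) (hNE : N.E = Set.univ)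
    (hN : ∀ B, N.IsBase B ↔ B ∈ minWeightBases M ω) : PartialOrder (ConnComponent N) where
  le C₁ C₂ := ∀ S ∈ tightSets M N, C₂.carrier ⊆ S → C₁.carrier ⊆ S
  le_refl _ _ _ h := h
  le_trans _ _ _ h h' S hS hC := h S hS (h' S hS hC)
  le_antisymm C₁ C₂ h h' := by
    obtain ⟨a, rfl⟩ := C₁.exists_eq_of hNE
    obtain ⟨b, rfl⟩ := C₂.exists_eq_of hNE
    rw [ConnComponent.of_eq_of_iff]
    refine exchangeEquiv_of_forall_mem_iff hM hN fun S hS => ?_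
    rw [← ConnComponent.of_carrier_subset_iff hNE hS, ← ConnComponent.of_carrier_subset_iff hNE hS]
    exact ⟨h' S hS, h S hS⟩

/-- The components can be numbered such that all initial segments are tight and a given tight set
is one of them. -/
theorem exists_index_of_mem_tightSets (hM : M.E = Set.univ) (hNE : N.E = Set.univ)
    (hN : ∀ B, N.IsBase B ↔ B ∈ minWeightBases M ω) {S : Set (Fin n)} (hS : S ∈ tightSets M N) :
    ∃ (m : ℕ) (f : Fin n → Fin m), Function.Surjective f ∧
      (∀ x y, f x = f y ↔ ExchangeEquiv N x y) ∧
      (∀ i : Fin (m + 1), {x | (f x).castSucc < i} ∈ tightSets M N) ∧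
      ∃ i : Fin (m + 1), {x | (f x).castSucc < i} = S := by
  classical
  let _ := componentOrder hM hNE hN
  -- As `false < true`, elements of `S` come first; ties are broken by a linear extension of the
  -- component order.
  let g : Fin n → Bool ×ₗ LinearExtension (ConnComponent N) := fun x =>
    toLex (decide (x ∉ S), toLinearExtension (ConnComponent.of hNE x))
  let s := Finset.univ.image g
  have hs : ∀ x, g x ∈ s := fun x => Finset.mem_image_of_mem g (Finset.mem_univ x)
  let e := s.orderIsoOfFin rfl
  let f : Fin n → Fin s.card := fun x => e.symm ⟨g x, hs x⟩
  have hle : ∀ x y, f x ≤ f y ↔ g x ≤ g y := fun x y => e.symm.le_iff_le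
  have hlt : ∀ x y, f x < f y ↔ g x < g y := fun x y => e.symm.lt_iff_lt
  refine ⟨s.card, f, fun i => ?_, fun x y => ?_, fun i => ?_, ?_⟩
  · obtain ⟨x, -, hx⟩ := Finset.mem_image.1 (e i).2
    exact ⟨x, by simp [f, hx]⟩
  · have h1 : f x = f y ↔ g x = g y := by simp [f]
    rw [h1, ← ConnComponent.of_eq_of_iff hNE]
    refine ⟨fun h => (congrArg (fun p => (ofLex p).2) h : _), fun h => ?_⟩
    have h2 : x ∈ S ↔ y ∈ S := by
      rw [← ConnComponent.of_carrier_subset_iff hNE hS, h,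
        ConnComponent.of_carrier_subset_iff hNE hS]
    simp only [g, h, h2]
  · refine mem_tightSets_of_forall hM (fun B hB => ((hN B).1 hB).1) fun a ha b hab => ?_
    refine lt_of_le_of_lt (Fin.castSucc_le_castSucc_iff.2 ((hle b a).2 ?_)) ha
    have hmon : ConnComponent.of hNE b ≤ ConnComponent.of hNE a := fun T hT h => by
      rw [ConnComponent.of_carrier_subset_iff hNE hT] at h ⊢
      exact hab T hT h
    rw [Prod.Lex.toLex_le_toLex']
    refine ⟨?_, fun _ => toLinearExtension.monotone hmon⟩
    by_cases haS : a ∈ S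
    · simp [haS, hab S hS haS]
    · simp [haS, Bool.le_true]
  · by_cases hSu : S = Set.univ
    · exact ⟨Fin.last _, by ext x; simp [hSu, Fin.castSucc_lt_last]⟩
    -- `S` is the segment before the least index that occurs outside `S`.
    obtain ⟨y, hy, hmin⟩ := Set.exists_min_image Sᶜ f (Set.toFinite _)
      (Set.nonempty_compl.2 hSu)
    refine ⟨(f y).castSucc, ?_⟩
    ext x
    refine ⟨fun hx => ?_, fun hx => ?_⟩
    · by_contra hxS
      exact (hmin x hxS).not_gt (Fin.castSucc_lt_castSucc_iff.1 hx)
    · refine Fin.castSucc_lt_castSucc_iff.2 ((hlt x y).2 ?_)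
      rw [Prod.Lex.toLex_lt_toLex]
      left
      simp [hx, show y ∉ S from hy]

theorem mem_faceLattice_iff (hM : M.E = Set.univ) (hNE : N.E = Set.univ)
    (hN : ∀ B, N.IsBase B ↔ B ∈ minWeightBases M ω) {S : Set (Fin n)} :
    S ∈ faceLattice M (basePolytope N) ↔ S ∈ tightSets M N := by
  constructor
  · rintro ⟨m, F, -, ⟨ω', hF, hσ⟩, i, rfl⟩
    -- The polytope determines the bases, so `ω'` defines the same `N` as `ω`.
    have hN' : ∀ B, N.IsBase B ↔ B ∈ minWeightBases M ω' := fun B =>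
      Set.ext_iff.1 (polytopeOf_injective hσ) B
    exact mem_tightSets_of_lt hM hN' fun x hx y hy => hF.lt hx hy
  · intro hS
    obtain ⟨m, f, hf, hfe, hft, i, hi⟩ := exists_index_of_mem_tightSets hM hNE hN hS
    refine ⟨m, SubsetFlag.ofIndex f hf, fun j => ?_,
      ⟨fun x => ((f x : ℕ) : ℝ), ⟨fun j a ha b hb => ?_, fun j k hjk a ha b hb => ?_⟩, ?_⟩, i, hi⟩
    · obtain ⟨x, hx⟩ := hf j
      refine isConnectedMatroid_restrict_contract
        ((SubsetFlag.ofIndex f hf).strictMono.monotone (Fin.castSucc_lt_succ).le)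
        (hft _) (hft _) ⟨x, (SubsetFlag.mem_block_ofIndex hf).2 hx⟩ fun a ha b hb => ?_
      rw [← hfe, (SubsetFlag.mem_block_ofIndex hf).1 ha, (SubsetFlag.mem_block_ofIndex hf).1 hb]
    · rw [SubsetFlag.mem_block_ofIndex] at ha hb
      simp only [ha, hb]
    · rw [SubsetFlag.mem_block_ofIndex] at ha hb
      change ((f a : ℕ) : ℝ) < (f b : ℕ)
      rw [ha, hb]
      exact Nat.cast_lt.2 hjk
    · set ω' : Fin n → ℝ := fun x => ((f x : ℕ) : ℝ) with hω'
      -- An `ω'`-minimal base and a base of `N` both contain a basis of every initial segment. Their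
      -- counts agree, hence so do both their `ω`- and `ω'`-weights, and the two families of
      -- minimizers coincide.
      have hcard : ∀ B ∈ minWeightBases M ω', ∀ B', N.IsBase B' → ∀ i : Fin (m + 1),
          (B ∩ {x | (f x).castSucc < i}).ncard = (B' ∩ {x | (f x).castSucc < i}).ncard := by
        intro B hB B' hB' i
        have h1 : M.IsBasis (B ∩ {x | (f x).castSucc < i}) {x | (f x).castSucc < i} := by
          refine hB.1.inter_isBasis_of_forall_not_isBase (by simp [hM])
            fun x hx hxB y hyB hyS hbase => ?_
          refine (le_of_mem_minWeightBases hB hxB hyB hbase).not_gt ?_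
          simp only [Set.mem_ofPred_eq, Fin.lt_def, Fin.val_castSucc] at hx hyS
          rw [hω', Nat.cast_lt]
          omega
        exact congrArg ENat.toNat (h1.encard_eq_encard (hft i B' hB'))
      have hw : ∀ B ∈ minWeightBases M ω', ∀ B', N.IsBase B' →
          setWeight ω B = setWeight ω B' ∧ setWeight ω' B = setWeight ω' B' := fun B hB B' hB' =>
        ⟨setWeight_eq_of_ncard_eq (fun x y hxy => weight_eq_of_exchangeEquiv hN ((hfe x y).1 hxy))
          (hcard B hB B' hB'), setWeight_eq_of_ncard_eq (fun x y hxy => by simp only [hω', hxy])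
          (hcard B hB B' hB')⟩
      refine congrArg polytopeOf (Set.Subset.antisymm (fun B hB => ?_) fun B hB => ?_)
      · obtain ⟨B₁, hB₁⟩ := minWeightBases_nonempty M ω'
        exact ⟨((hN B).1 hB).1, fun B' hB' => (hw B₁ hB₁ B hB).2 ▸ hB₁.2 B' hB'⟩
      · obtain ⟨B₁, hB₁⟩ := N.exists_isBase
        exact (hN B).2 ⟨hB.1, fun B' hB' => (hw B hB B₁ hB₁).1 ▸ ((hN B₁).1 hB₁).2 B' hB'⟩

end

theorem mainTheorem1 (n : ℕ) (M : Matroid (Fin n)) (hM : M.E = Set.univ)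
    (σ : Set (Fin n → ℝ)) (hσ : IsFaceOf σ M) :
    (∃! N : Matroid (Fin n), N.E = Set.univ ∧ basePolytope N = σ) ∧
    ∀ Mσ : Matroid (Fin n), Mσ.E = Set.univ → basePolytope Mσ = σ →
      ∃ _ : PartialOrder (ConnComponent Mσ),
        (∀ C₁ C₂ : ConnComponent Mσ, C₁ ≠ C₂ →
          (C₁ < C₂ ↔ ∀ S : Set (Fin n),
            C₂.carrier ⊆ S → σ ⊆ rankHyperplane M S → C₁.carrier ⊆ S)) ∧
        IsSublattice (faceLattice M σ) ∧
        ∃ φ : faceLattice M σ ≃o LowerSet (ConnComponent Mσ),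
          (∀ (S : faceLattice M σ) (C : ConnComponent Mσ),
            C ∈ φ S ↔ C.carrier ⊆ (S : Set (Fin n))) ∧
          ∀ I : LowerSet (ConnComponent Mσ),
            (φ.symm I : Set (Fin n)) = ⋃ C ∈ I, C.carrier := by
  obtain ⟨ω, rfl⟩ := hσ.exists_eq_polytopeOf
  have hbase : ∀ N : Matroid (Fin n), basePolytope N = polytopeOf (minWeightBases M ω) →
      ∀ B, N.IsBase B ↔ B ∈ minWeightBases M ω := fun N hN B =>
    Set.ext_iff.1 (polytopeOf_injective hN) B
  refine ⟨?_, fun N hNE hNσ => ?_⟩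
  · obtain ⟨N, hNE, hN⟩ := exists_matroid_isBase_iff_mem_minWeightBases M ω
    refine ⟨N, ⟨hNE, congrArg polytopeOf (Set.ext hN)⟩, fun N' ⟨hNE', hN'⟩ => ?_⟩
    exact Matroid.ext_isBase (hNE'.trans hNE.symm) fun B _ =>
      (hbase N' hN' B).trans (hN B).symm
  have hN := hbase N hNσ
  have hNM : ∀ B, N.IsBase B → M.IsBase B := fun B hB => ((hN B).1 hB).1
  have hface : faceLattice M (basePolytope N) = tightSets M N :=
    Set.ext fun S => mem_faceLattice_iff hM hNE hN
  have hplane : ∀ S, basePolytope N ⊆ rankHyperplane M S ↔ S ∈ tightSets M N := fun S =>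
    polytopeOf_subset_rankHyperplane hM hNM
  rw [← hNσ, hface]
  let _ := componentOrder hM hNE hN
  -- A down-set of components is closed under the preorder defined by tight sets.
  have hunion : ∀ I : LowerSet (ConnComponent N), (⋃ C ∈ I, C.carrier) ∈ tightSets M N := by
    refine fun I => mem_tightSets_of_forall hM hNM fun a ha b hab => ?_
    simp only [Set.mem_iUnion, exists_prop] at ha ⊢
    obtain ⟨C, hC, ha⟩ := ha
    obtain rfl := ConnComponent.eq_of_mem hNE ha
    refine ⟨ConnComponent.of hNE b, I.lower (fun S hS h => ?_) hC,
      (ConnComponent.mem_of_iff hNE).2 (Or.inl rfl)⟩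
    rw [ConnComponent.of_carrier_subset_iff hNE hS] at h ⊢
    exact hab S hS h
  refine ⟨inferInstance, fun C₁ C₂ hC => ?_, isSublattice_tightSets hNM, ?_⟩
  · rw [lt_iff_le_and_ne, and_iff_left hC]
    simp only [hplane]
    exact ⟨fun h S h2 hS => h S hS h2, fun h S hS h2 => h S h2 hS⟩
  let φ : tightSets M N ≃o LowerSet (ConnComponent N) :=
    { toFun := fun S => ⟨{C | C.carrier ⊆ S}, fun _ _ hle h => hle S S.2 h⟩
      invFun := fun I => ⟨⋃ C ∈ I, C.carrier, hunion I⟩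
      left_inv := fun S => by
        ext a
        simp only [Set.mem_iUnion, exists_prop]
        refine ⟨fun ⟨C, hC, ha⟩ => hC ha, fun ha => ⟨ConnComponent.of hNE a,
          (ConnComponent.of_carrier_subset_iff hNE S.2).2 ha,
          (ConnComponent.mem_of_iff hNE).2 (Or.inl rfl)⟩⟩
      right_inv := fun I => by
        ext C
        refine ⟨fun h => ?_, fun h => Set.subset_biUnion_of_mem (u := ConnComponent.carrier) h⟩
        obtain ⟨a, rfl⟩ := C.exists_eq_of hNE
        have ha := h ((ConnComponent.mem_of_iff hNE).2 (Or.inl rfl))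
        simp only [Set.mem_iUnion, exists_prop] at ha
        obtain ⟨C, hC, ha⟩ := ha
        exact ConnComponent.eq_of_mem hNE ha ▸ hC
      map_rel_iff' := fun {S T} => by
        refine ⟨fun h a ha => ?_, fun h C hC => Set.Subset.trans (b := S.1) hC h⟩
        exact (ConnComponent.of_carrier_subset_iff hNE T.2).1
          (h ((ConnComponent.of_carrier_subset_iff hNE S.2).2 ha)) }
  exact ⟨φ, fun S C => Iff.rfl, fun I => rfl⟩
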